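/- Let $H\in(0,1)$ and $\nu>0$. Let $B_H=(B_H(t))_{t\ge 0}$ be a fractional Brownian motion with Hurst exponent $H$, i.e. a centred Gaussian process with a.s. continuous paths and $$\mathrm{Cov}(B_H(s),B_H(t))=\tfrac12\left(s^{2H}+t^{2H}-|t-s|^{2H}\right),\qquad s,t\ge 0.$$ Let $U=(U(t))_{t\ge0}$ be a gamma process with parameter $\nu$, independent of $B_H$, i.e. a Lévy process (started at $0$, with independent increments and a.s. càdlàg paths) such that for all $t\ge0$, $h>0$ the increment $U(t+h)-U(t)$ has density $x^{h/\nu-1}e^{-x}/\Gamma(h/\nu)$ on $(0,\infty)$. Let $V(t)=\inf\{\tau\ge 0: U(\tau)>t\}$ be the first-exit (inverse) process of $U$, and let $Y_2(t)=B_H(V(t))$, $t\ge0$. Then $Y_2$ has long-range dependence, in the following sense: $Y_2(t)$ has finite variance for every $t\ge 0$, and there are $d\in(0,1)$ and, for every $s>0$, a constant $c(s)\neq 0$ such that for every fixed $s>0$ $$\mathrm{Corr}(Y_2(s),Y_2(t))\sim c(s)\,t^{-d}\qquad\text{as } t\to\infty.$$ The exponent $d$ does not depend on $s$. -/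

import Mathlib

open MeasureTheory ProbabilityTheory Filter Topology Asymptotics
open scoped NNReal

/-- `B` is a fractional Brownian motion with Hurst exponent `H`: a centred Gaussian process with
almost surely continuous paths and the standard covariance function. -/
structure IsFBM {Ω : Type*} [MeasurableSpace Ω] (H : ℝ) (B : ℝ≥0 → Ω → ℝ) (P : Measure Ω) :
    Prop where
  measurable : ∀ t, Measurable (B t)
  gaussian : IsGaussianProcess B P
  centered : ∀ t, ∫ ω, B t ω ∂P = 0
  covariance_eq : ∀ s t : ℝ≥0, cov[B s, B t; P] =
    ((s : ℝ) ^ (2 * H) + (t : ℝ) ^ (2 * H) - |(t : ℝ) - (s : ℝ)| ^ (2 * H)) / 2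
  continuous : ∀ᵐ ω ∂P, Continuous fun t => B t ω

/-- `U` is a gamma process with parameter `ν`: a Lévy process whose increments over intervals of
length `h > 0` have the gamma law with shape `h / ν` and scale `1`. -/
structure IsGammaProcess {Ω : Type*} [MeasurableSpace Ω] (ν : ℝ) (U : ℝ≥0 → Ω → ℝ)
    (P : Measure Ω) : Prop where
  measurable : ∀ t, Measurable (U t)
  zero : ∀ᵐ ω ∂P, U 0 ω = 0
  indep : HasIndepIncrements U P
  law : ∀ t h : ℝ≥0, 0 < h → HasLaw (fun ω => U (t + h) ω - U t ω) (gammaMeasure (h / ν) 1) P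
  cadlag : ∀ᵐ ω ∂P, ∀ t : ℝ≥0, ContinuousWithinAt (fun r => U r ω) (Set.Ici t) t ∧
    ∃ l : ℝ, Tendsto (fun r => U r ω) (𝓝[<] t) (𝓝 l)

/-- The first-exit time (inverse) process `V(t) = inf {τ ≥ 0 : U(τ) > t}`. The set is almost surely
nonempty for a gamma process; where it is empty the infimum is `0` by convention. -/
noncomputable def firstExit {Ω : Type*} (U : ℝ≥0 → Ω → ℝ) (t : ℝ≥0) (ω : Ω) : ℝ≥0 :=
  sInf {τ : ℝ≥0 | (t : ℝ) < U τ ω}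

/-- The time-changed process `t ↦ X(T(t))`. -/
def timeChange {Ω : Type*} (X : ℝ≥0 → Ω → ℝ) (T : ℝ≥0 → Ω → ℝ≥0) (t : ℝ≥0) (ω : Ω) : ℝ :=
  X (T t ω) ω

/-- The correlation coefficient. -/
noncomputable def corr {Ω : Type*} [MeasurableSpace Ω] (X Y : Ω → ℝ) (P : Measure Ω) : ℝ :=
  cov[X, Y; P] / (√(Var[X; P]) * √(Var[Y; P]))

/-- Long-range dependence of a (possibly non-stationary) finite-variance process: there is one
`d ∈ (0, 1)` such that for each fixed `s > 0`, `Corr(X(s), X(t)) ∼ c(s) t ^ (-d)` as `t → ∞`, with a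
nonzero constant `c(s)` depending only on `s`. -/
structure HasLRD {Ω : Type*} [MeasurableSpace Ω] (X : ℝ≥0 → Ω → ℝ) (P : Measure Ω) : Prop where
  memLp_two : ∀ t, MemLp (X t) 2 P
  corr_isEquivalent : ∃ d ∈ Set.Ioo (0 : ℝ) 1, ∃ c : ℝ≥0 → ℝ, ∀ s : ℝ≥0, 0 < s →
    c s ≠ 0 ∧ (fun t : ℝ≥0 => corr (X s) (X t) P) ~[atTop] fun t => c s * (t : ℝ) ^ (-d)

/-! Put p = 2H and let V be the exit process. Since V is independent of the fractional Brownian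
motion, freezing V gives Cov(Y(s), Y(t)) = ½ E[V(s)^p + V(t)^p − |V(t) − V(s)|^p] and Var Y(t) =
E[V(t)^p] (`integral_pathEval_mul`). Only the growth of V then matters.

The strong law gives U(n)/n → m > 0. As U is monotone, its inverse satisfies V(t)/t → μ = 1/m almost
surely. An exponential-moment bound gives V(t) ≤ K(1+t)D for all t with D square-integrable
(`exists_firstExit_le`), which justifies dominated convergence. Hence Var Y(t) ∼ (μt)^p.

In the covariance, V(t)^p − (V(t) − V(s))^p behaves like p μ^(p−1) V(s) t^(p−1). For p < 1 this
vanishes and E[V(s)^p]/2 remains; for p ≥ 1 the covariance has order t^(p−1) (`exists_tendsto_cov`).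
Dividing by the standard deviation, of order t^H, yields d = H − max(2H−1, 0) = min(H, 1−H). -/

open scoped ENNReal

/-! ### Laplace transform and first moment of the gamma law -/

section Gamma

lemma gammaMeasure_ae_pos (a r : ℝ) : ∀ᵐ x ∂(gammaMeasure a r), 0 < x := by
  have h : gammaMeasure a r (Set.Iic 0) = 0 := by
    rw [gammaMeasure, withDensity_apply _ measurableSet_Iic, setLIntegral_congr Iio_ae_eq_Iic.symm]
    exact lintegral_gammaPDF_of_nonpos le_rfl
  rw [ae_iff]
  simp only [not_lt]
  exact h

lemma measurable_gammaPDF (a r : ℝ) : Measurable (gammaPDF a r) :=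
  (measurable_gammaPDFReal a r).ennreal_ofReal

/-- Exponential tilting turns the rate-1 density into a constant multiple of the density with rate
`1 + θ`. -/
lemma lintegral_exp_neg_mul_gammaMeasure {a θ : ℝ} (ha : 0 < a) (hθ : 0 ≤ θ) :
    ∫⁻ x, ENNReal.ofReal (Real.exp (-(θ * x))) ∂(gammaMeasure a 1)
      = ENNReal.ofReal ((1 + θ) ^ (-a)) := by
  have h1 : 0 < 1 + θ := by linarith
  rw [gammaMeasure, lintegral_withDensity_eq_lintegral_mul _ (measurable_gammaPDF a 1)
    (by fun_prop)]
  have key : ∀ x, (gammaPDF a 1 * fun x => ENNReal.ofReal (Real.exp (-(θ * x)))) x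
      = ENNReal.ofReal ((1 + θ) ^ (-a)) * gammaPDF a (1 + θ) x := by
    intro x
    simp only [Pi.mul_apply]
    rcases lt_or_ge x 0 with hx | hx
    · simp [gammaPDF_of_neg hx]
    · rw [gammaPDF_of_nonneg hx, gammaPDF_of_nonneg hx, ← ENNReal.ofReal_mul (by positivity),
        ← ENNReal.ofReal_mul (by positivity)]
      congr 1
      have h2 : (1 + θ) ^ (-a) * (1 + θ) ^ a = 1 := by
        rw [← Real.rpow_add h1]; simp
      have h3 : Real.exp (-((1 + θ) * x)) = Real.exp (-(1 * x)) * Real.exp (-(θ * x)) := by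
        rw [← Real.exp_add]; congr 1; ring
      rw [h3, Real.one_rpow]
      linear_combination (-(1 / Real.Gamma a * x ^ (a - 1) * Real.exp (-(1 * x))
        * Real.exp (-(θ * x)))) * h2
  simp_rw [key]
  rw [lintegral_const_mul _ (measurable_gammaPDF _ _), lintegral_gammaPDF_eq_one ha h1, mul_one]

/-- Size biasing: x times the density of shape `a` is `a` times the density of shape `a + 1`. -/
lemma integrable_id_gammaMeasure {a : ℝ} (ha : 0 < a) :
    Integrable (fun x => x) (gammaMeasure a 1) := by
  refine ⟨aestronglyMeasurable_id, ?_⟩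
  rw [hasFiniteIntegral_iff_enorm, gammaMeasure,
    lintegral_withDensity_eq_lintegral_mul _ (measurable_gammaPDF a 1) (by fun_prop)]
  have key : ∀ x, (gammaPDF a 1 * fun x : ℝ => ‖x‖ₑ) x
      = ENNReal.ofReal a * gammaPDF (a + 1) 1 x := by
    intro x
    simp only [Pi.mul_apply]
    rcases lt_or_ge x 0 with hx | hx
    · simp [gammaPDF_of_neg hx]
    · rw [gammaPDF_of_nonneg hx, gammaPDF_of_nonneg hx, Real.enorm_eq_ofReal hx,
        ← ENNReal.ofReal_mul (by positivity), ← ENNReal.ofReal_mul (by positivity)]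
      congr 1
      rcases hx.eq_or_lt with rfl | hx
      · simp [Real.zero_rpow ha.ne']
      rw [Real.Gamma_add_one ha.ne', Real.one_rpow, Real.one_rpow, add_sub_cancel_right,
        Real.rpow_sub_one hx.ne']
      have := (Real.Gamma_pos_of_pos ha).ne'
      field_simp
  simp_rw [key]
  rw [lintegral_const_mul _ (measurable_gammaPDF _ _),
    lintegral_gammaPDF_eq_one (by linarith) one_pos, mul_one]
  exact ENNReal.ofReal_lt_top

end Gamma

/-! ### Deterministic inversion of monotone paths -/

section Paths

/-- A right-continuous function on `ℝ≥0` that is monotone on a dense sequence is monotone. -/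
lemma monotone_of_denseSeq {f : ℝ≥0 → ℝ} (hf : ∀ t, ContinuousWithinAt f (Set.Ici t) t)
    (hd : ∀ i j, TopologicalSpace.denseSeq ℝ≥0 i ≤ TopologicalSpace.denseSeq ℝ≥0 j →
      f (TopologicalSpace.denseSeq ℝ≥0 i) ≤ f (TopologicalSpace.denseSeq ℝ≥0 j)) :
    Monotone f := by
  -- Right-continuity supplies points of the dense sequence just to the right of `t` with values
  -- near `f t`.
  have approx : ∀ (t b : ℝ≥0) (u : Set ℝ), t < b → u ∈ 𝓝 (f t) →
      ∃ i, TopologicalSpace.denseSeq ℝ≥0 i ∈ Set.Ioo t b ∧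
        f (TopologicalSpace.denseSeq ℝ≥0 i) ∈ u := by
    intro t b u htb hu
    obtain ⟨c, hc, hcu⟩ := (mem_nhdsGE_iff_exists_Ico_subset' htb).1 (hf t hu)
    have hne : (Set.Ioo t (min b c)).Nonempty := Set.nonempty_Ioo.2 (lt_min htb hc)
    obtain ⟨i, hi⟩ := (TopologicalSpace.denseRange_denseSeq ℝ≥0).exists_mem_open isOpen_Ioo hne
    exact ⟨i, ⟨hi.1, hi.2.trans_le (min_le_left _ _)⟩,
      hcu ⟨hi.1.le, hi.2.trans_le (min_le_right _ _)⟩⟩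
  intro s t hst
  rcases hst.eq_or_lt with rfl | hst
  · exact le_rfl
  by_contra! h
  obtain ⟨c, hc1, hc2⟩ := exists_between h
  obtain ⟨i, hi, hi'⟩ := approx s t (Set.Ioi c) hst (Ioi_mem_nhds hc2)
  obtain ⟨j, hj, hj'⟩ := approx t (t + 1) (Set.Iio c) (by simp) (Iio_mem_nhds hc1)
  have := hd i j (hi.2.le.trans hj.1.le)
  exact absurd (this.trans_lt hj') (not_lt.2 (le_of_lt hi'))

lemma le_of_lt_sInf_exit {f : ℝ≥0 → ℝ} {t : ℝ} {τ : ℝ≥0} (h : τ < sInf {τ : ℝ≥0 | t < f τ}) :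
    f τ ≤ t :=
  not_lt.1 fun h' => notMem_of_lt_csInf h (OrderBot.bddBelow _) h'

lemma lt_of_sInf_exit_lt {f : ℝ≥0 → ℝ} (hf : Monotone f) {t : ℝ} {τ : ℝ≥0}
    (hne : {τ : ℝ≥0 | t < f τ}.Nonempty) (h : sInf {τ : ℝ≥0 | t < f τ} < τ) : t < f τ := by
  obtain ⟨x, hx, hxτ⟩ := exists_lt_of_csInf_lt hne h
  exact lt_of_lt_of_le hx (hf hxτ.le)

lemma tendsto_atTop_of_div_nat {f : ℝ≥0 → ℝ} {m : ℝ} (hm : 0 < m)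
    (hlim : Tendsto (fun n : ℕ => f n / n) atTop (𝓝 m)) :
    Tendsto (fun n : ℕ => f n) atTop atTop := by
  have h := hlim.pos_mul_atTop hm (tendsto_natCast_atTop_atTop (R := ℝ))
  refine h.congr' ?_
  filter_upwards [eventually_ge_atTop 1] with n hn
  have : (n : ℝ) ≠ 0 := by positivity
  field_simp

lemma exit_nonempty {f : ℝ≥0 → ℝ} {m : ℝ} (hm : 0 < m)
    (hlim : Tendsto (fun n : ℕ => f n / n) atTop (𝓝 m)) (t : ℝ) :
    {τ : ℝ≥0 | t < f τ}.Nonempty := by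
  obtain ⟨n, hn⟩ := ((tendsto_atTop_of_div_nat hm hlim).eventually_gt_atTop t).exists
  exact ⟨n, hn⟩

lemma monotone_sInf_exit {f : ℝ≥0 → ℝ} {m : ℝ} (hm : 0 < m)
    (hlim : Tendsto (fun n : ℕ => f n / n) atTop (𝓝 m)) :
    Monotone fun t : ℝ≥0 => sInf {τ : ℝ≥0 | (t : ℝ) < f τ} := by
  intro s t hst
  refine csInf_le_csInf (OrderBot.bddBelow _) (exit_nonempty hm hlim t) fun τ hτ => ?_
  have : (s : ℝ) ≤ t := by exact_mod_cast hst
  exact this.trans_lt hτ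

lemma tendsto_sInf_exit_atTop {f : ℝ≥0 → ℝ} (hf : Monotone f) {m : ℝ} (hm : 0 < m)
    (hlim : Tendsto (fun n : ℕ => f n / n) atTop (𝓝 m)) :
    Tendsto (fun t : ℝ≥0 => sInf {τ : ℝ≥0 | (t : ℝ) < f τ}) atTop atTop := by
  refine tendsto_atTop.2 fun N => ?_
  filter_upwards [eventually_ge_atTop (Real.toNNReal (f N))] with t ht
  by_contra! h
  have h1 := lt_of_sInf_exit_lt hf (exit_nonempty hm hlim t) h
  have h2 : f N ≤ t := (Real.le_coe_toNNReal _).trans (by exact_mod_cast ht)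
  linarith

/-- The generalized inverse of a monotone function of linear growth `m` has growth `m⁻¹`. -/
lemma tendsto_sInf_exit_div {f : ℝ≥0 → ℝ} (hf : Monotone f) {m : ℝ} (hm : 0 < m)
    (hlim : Tendsto (fun n : ℕ => f n / n) atTop (𝓝 m)) :
    Tendsto (fun t : ℝ≥0 => ((sInf {τ : ℝ≥0 | (t : ℝ) < f τ} : ℝ≥0) : ℝ) / t) atTop
      (𝓝 m⁻¹) := by
  set v : ℝ≥0 → ℝ≥0 := fun t => sInf {τ : ℝ≥0 | (t : ℝ) < f τ} with hv
  have hvtop : Tendsto (fun t => (v t : ℝ)) atTop atTop :=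
    NNReal.tendsto_coe_atTop.2 (tendsto_sInf_exit_atTop hf hm hlim)
  have hfl : Tendsto (fun t => ⌊(v t : ℝ)⌋₊) atTop atTop := tendsto_nat_floor_atTop.comp hvtop
  have hratio : Tendsto (fun t => (⌊(v t : ℝ)⌋₊ : ℝ) / v t) atTop (𝓝 1) :=
    (tendsto_nat_floor_div_atTop (R := ℝ)).comp hvtop
  have hinv : Tendsto (fun t => (v t : ℝ)⁻¹) atTop (𝓝 0) := tendsto_inv_atTop_zero.comp hvtop
  have up : Tendsto (fun t => f ((⌊(v t : ℝ)⌋₊ + 1 : ℕ) : ℝ≥0) / v t) atTop (𝓝 m) := by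
    have h1 := (hlim.comp ((tendsto_add_atTop_nat 1).comp hfl)).mul (hratio.add hinv)
    rw [add_zero, mul_one] at h1
    refine h1.congr fun t => ?_
    simp only [Function.comp]
    have : (((⌊(v t : ℝ)⌋₊ + 1 : ℕ) : ℝ)) ≠ 0 := by positivity
    rw [show (⌊(v t : ℝ)⌋₊ : ℝ) / v t + (v t : ℝ)⁻¹ = ((⌊(v t : ℝ)⌋₊ + 1 : ℕ) : ℝ) / v t by
      push_cast; ring]
    field_simp
  have low : Tendsto (fun t => f ((⌊(v t : ℝ)⌋₊ - 1 : ℕ) : ℝ≥0) / v t) atTop (𝓝 m) := by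
    have h1 := (hlim.comp ((tendsto_sub_atTop_nat 1).comp hfl)).mul (hratio.sub hinv)
    rw [sub_zero, mul_one] at h1
    refine h1.congr' ?_
    filter_upwards [hfl.eventually_ge_atTop 2] with t ht
    simp only [Function.comp]
    have h0 : (((⌊(v t : ℝ)⌋₊ - 1 : ℕ) : ℝ)) ≠ 0 := by
      have : 0 < ⌊(v t : ℝ)⌋₊ - 1 := by omega
      positivity
    rw [show (⌊(v t : ℝ)⌋₊ : ℝ) / v t - (v t : ℝ)⁻¹ = ((⌊(v t : ℝ)⌋₊ - 1 : ℕ) : ℝ) / v t by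
      rw [Nat.cast_sub (by omega)]; push_cast; ring]
    field_simp
  -- Sandwich f(⌊v⌋ − 1) ≤ t ≤ f(⌊v⌋ + 1). The shifts by one keep the arguments strictly off the
  -- infimum `v`, where the position of f relative to t is not known.
  have hmid : Tendsto (fun t : ℝ≥0 => (t : ℝ) / v t) atTop (𝓝 m) := by
    refine tendsto_of_tendsto_of_tendsto_of_le_of_le' low up ?_ ?_
    · filter_upwards [hvtop.eventually_ge_atTop 1] with t ht
      refine div_le_div_of_nonneg_right (le_of_lt_sInf_exit ?_) (v t).2
      change ((⌊(v t : ℝ)⌋₊ - 1 : ℕ) : ℝ≥0) < v t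
      have h1 : 1 ≤ ⌊(v t : ℝ)⌋₊ := Nat.one_le_floor_iff _ |>.2 ht
      have h2 := Nat.floor_le (v t).2
      rw [← NNReal.coe_lt_coe, NNReal.coe_natCast, Nat.cast_sub h1]
      push_cast
      change (⌊(v t : ℝ)⌋₊ : ℝ) ≤ v t at h2
      linarith
    · refine Eventually.of_forall fun t => ?_
      refine div_le_div_of_nonneg_right (lt_of_sInf_exit_lt hf (exit_nonempty hm hlim t) ?_).le
        (v t).2
      change v t < _
      rw [← NNReal.coe_lt_coe, NNReal.coe_natCast]
      push_cast
      exact Nat.lt_floor_add_one _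
  exact (hmid.inv₀ hm.ne').congr fun t => inv_div _ _

end Paths

/-! ### Almost sure growth of the gamma process and its inverse -/

namespace IsGammaProcess

variable {Ω : Type*} [MeasurableSpace Ω] {P : Measure Ω} {ν : ℝ} {U : ℝ≥0 → Ω → ℝ}

lemma ae_lt (hU : IsGammaProcess ν U P) {s t : ℝ≥0} (hst : s < t) :
    ∀ᵐ ω ∂P, U s ω < U t ω := by
  have h := hU.law s (t - s) (tsub_pos_of_lt hst)
  rw [add_tsub_cancel_of_le hst.le] at h
  filter_upwards [(h.ae_iff (p := fun x => 0 < x) (measurableSet_Ioi (a := (0 : ℝ))).mem).2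
    (gammaMeasure_ae_pos _ _)] with ω hω
  linarith

/-- Positivity of increments holds almost surely for countably many pairs of times at once;
right-continuity extends it to all times. -/
lemma ae_monotone (hU : IsGammaProcess ν U P) : ∀ᵐ ω ∂P, Monotone fun t => U t ω := by
  have h : ∀ᵐ ω ∂P, ∀ i j,
      TopologicalSpace.denseSeq ℝ≥0 i ≤ TopologicalSpace.denseSeq ℝ≥0 j →
      U (TopologicalSpace.denseSeq ℝ≥0 i) ω ≤ U (TopologicalSpace.denseSeq ℝ≥0 j) ω := by
    refine ae_all_iff.2 fun i => ae_all_iff.2 fun j => ?_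
    rcases lt_or_ge (TopologicalSpace.denseSeq ℝ≥0 i) (TopologicalSpace.denseSeq ℝ≥0 j)
      with hij | hij
    · filter_upwards [hU.ae_lt hij] with ω hω _ using hω.le
    · exact ae_of_all _ fun ω h' => (congrArg (fun x => U x ω) (le_antisymm h' hij)).le
  filter_upwards [h, hU.cadlag] with ω h1 h2
  exact monotone_of_denseSeq (fun t => (h2 t).1) h1

/-- Strong law of large numbers along the integers. -/
lemma exists_ae_tendsto_div [IsProbabilityMeasure P] (hU : IsGammaProcess ν U P) (hν : 0 < ν) :
    ∃ m : ℝ, 0 < m ∧ ∀ᵐ ω ∂P, Tendsto (fun n : ℕ => U n ω / n) atTop (𝓝 m) := by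
  set X : ℕ → Ω → ℝ := fun n ω => U ((n + 1 : ℕ) : ℝ≥0) ω - U (n : ℝ≥0) ω with hX
  have hmono : Monotone fun n : ℕ => (n : ℝ≥0) := Nat.mono_cast
  have hlaw : ∀ n, HasLaw (X n) (gammaMeasure (1 / ν) 1) P := by
    intro n
    have := hU.law n 1 one_pos
    simpa [hX] using this
  have hint : Integrable (X 0) P := by
    have h := integrable_id_gammaMeasure (a := 1 / ν) (by positivity)
    rw [← (hlaw 0).map_eq] at h
    exact (integrable_map_measure aestronglyMeasurable_id (hlaw 0).aemeasurable).1 h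
  have hindep : Pairwise (Function.onFun (fun f g => IndepFun f g P) X) := fun i j hij =>
    (hU.indep.nat hmono).indepFun hij
  have hident : ∀ i, IdentDistrib (X i) (X 0) P P := fun i =>
    ⟨(hlaw i).aemeasurable, (hlaw 0).aemeasurable, by rw [(hlaw i).map_eq, (hlaw 0).map_eq]⟩
  have hpos : ∀ᵐ ω ∂P, 0 < X 0 ω := by
    filter_upwards [hU.ae_lt (s := ((0 : ℕ) : ℝ≥0)) (t := ((0 + 1 : ℕ) : ℝ≥0)) (by simp)] with ω hω
    simpa [hX] using hω
  refine ⟨∫ ω, X 0 ω ∂P, ?_, ?_⟩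
  · rw [integral_pos_iff_support_of_nonneg_ae (hpos.mono fun _ h => h.le) hint]
    have : Function.support (X 0) =ᵐ[P] Set.univ := by
      filter_upwards [hpos] with ω hω
      exact eq_true hω.ne'
    rw [measure_congr this]
    simp
  · filter_upwards [strong_law_ae_real X hint hindep hident, hU.zero] with ω h1 h0
    refine h1.congr fun n => ?_
    rw [hX, Finset.sum_range_sub (fun n : ℕ => U (n : ℝ≥0) ω)]
    simp [h0]

/-- The first exit times grow at most linearly, uniformly in time, up to a square-integrable
random factor. -/
lemma exists_firstExit_le [IsProbabilityMeasure P] (hU : IsGammaProcess ν U P) (hν : 0 < ν) :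
    ∃ (K : ℝ) (D : Ω → ℝ), 1 ≤ K ∧ (∀ ω, 1 ≤ D ω) ∧
      Integrable (fun ω => D ω ^ 2) P ∧
      ∀ᵐ ω ∂P, ∀ t : ℝ≥0, (firstExit U t ω : ℝ) ≤ K * (1 + t) * D ω := by
  -- Chosen so that 1 + θ = e^(3ν), hence E e^(−θU(n)) = e^(−3n). This beats the weight e^(2n), and
  -- the terms of `W` have the summable means e^(−n).
  set θ : ℝ := Real.exp (3 * ν) - 1 with hθdef
  have hθ : 0 ≤ θ := by
    have := Real.one_le_exp (x := 3 * ν) (by positivity)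
    linarith
  set W : Ω → ℝ≥0∞ := fun ω => ∑' n : ℕ, ENNReal.ofReal (Real.exp (2 * n - θ * U n ω)) with hW
  have hUm := hU.measurable
  have hWm : Measurable W := by
    refine Measurable.tsum fun n => ?_
    exact (((hUm n).const_mul θ).const_sub (2 * (n : ℝ))).exp.ennreal_ofReal
  have hterm : ∀ n : ℕ, ∫⁻ ω, ENNReal.ofReal (Real.exp (2 * n - θ * U n ω)) ∂P
      = ENNReal.ofReal (Real.exp (-1) ^ n) := by
    intro n
    rcases Nat.eq_zero_or_pos n with rfl | hn
    · have : ∀ᵐ ω ∂P, ENNReal.ofReal (Real.exp (2 * (0 : ℕ) - θ * U (0 : ℕ) ω)) = 1 := by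
        filter_upwards [hU.zero] with ω h0
        simp [h0]
      rw [lintegral_congr_ae this]
      simp
    · have hl := hU.law 0 n (by exact_mod_cast hn)
      have hn' : (0 : ℝ) < ((n : ℝ≥0) : ℝ) / ν := by
        have : (0 : ℝ) < n := by exact_mod_cast hn
        simpa using div_pos this hν
      have h1 := hl.lintegral_comp (f := fun x => ENNReal.ofReal (Real.exp (-(θ * x))))
        (by fun_prop)
      rw [lintegral_exp_neg_mul_gammaMeasure hn' hθ] at h1
      have : ∀ᵐ ω ∂P, ENNReal.ofReal (Real.exp (2 * n - θ * U n ω))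
          = ENNReal.ofReal (Real.exp (2 * n)) *
            ENNReal.ofReal (Real.exp (-(θ * (U (0 + n) ω - U 0 ω)))) := by
        filter_upwards [hU.zero] with ω h0
        rw [← ENNReal.ofReal_mul (Real.exp_pos _).le, ← Real.exp_add, h0, zero_add]
        congr 2
        ring
      rw [lintegral_congr_ae this, lintegral_const_mul', h1,
        ← ENNReal.ofReal_mul (Real.exp_pos _).le]
      · congr 1
        rw [show 1 + θ = Real.exp (3 * ν) by rw [hθdef]; ring, ← Real.exp_mul, ← Real.exp_add,
          ← Real.exp_nat_mul]
        congr 1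
        simp only [NNReal.coe_natCast]
        field_simp
        ring
      · exact ENNReal.ofReal_ne_top
  have hWint : ∫⁻ ω, W ω ∂P ≠ ∞ := by
    rw [hW, lintegral_tsum fun n => ?_]
    · simp_rw [hterm]
      rw [← ENNReal.ofReal_tsum_of_nonneg (fun n => by positivity)]
      · exact ENNReal.ofReal_ne_top
      · exact summable_geometric_of_lt_one (Real.exp_pos _).le (by simp)
    · exact (((hUm n).const_mul θ).const_sub (2 * (n : ℝ))).exp.ennreal_ofReal.aemeasurable
  have hWtop : ∀ᵐ ω ∂P, W ω < ∞ := ae_lt_top hWm hWint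
  -- The logarithm turns an integrable `W` into a square-integrable `Z`: from 1 + z + z²/2 ≤ e^z one
  -- gets (1 + Z)² ≤ 1 + 2W.
  set Z : Ω → ℝ := fun ω => Real.log (1 + (W ω).toReal) with hZ
  have hZ0 : ∀ ω, 0 ≤ Z ω := fun ω => Real.log_nonneg (by simp)
  have hZm : Measurable Z := (hWm.ennreal_toReal.const_add 1).log
  have hWr : Integrable (fun ω => (W ω).toReal) P :=
    integrable_toReal_of_lintegral_ne_top hWm.aemeasurable hWint
  refine ⟨1 + θ, fun ω => 1 + Z ω, by linarith, fun ω => by linarith [hZ0 ω], ?_, ?_⟩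
  · refine ((integrable_const (1 : ℝ)).add (hWr.const_mul 2)).mono'
      (by fun_prop) (ae_of_all _ fun ω => ?_)
    have h1 := Real.quadratic_le_exp_of_nonneg (hZ0 ω)
    have h2 : Real.exp (Z ω) = 1 + (W ω).toReal :=
      Real.exp_log (by have := (W ω).toReal_nonneg; linarith)
    rw [Real.norm_of_nonneg (by positivity)]
    simp only [Pi.add_apply]
    nlinarith
  · filter_upwards [hWtop] with ω hω t
    -- If n lies before the exit time, then U(n) ≤ t, so a single term of the series already forces
    -- e^(2n − θt) ≤ W.
    have key : ∀ n : ℕ, (n : ℝ≥0) < firstExit U t ω → 2 * n - θ * t ≤ Z ω := by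
      intro n hn
      have h1 : U n ω ≤ t := le_of_lt_sInf_exit (f := fun τ => U τ ω) hn
      have h2 : ENNReal.ofReal (Real.exp (2 * n - θ * U n ω)) ≤ W ω :=
        ENNReal.le_tsum (f := fun n : ℕ => ENNReal.ofReal (Real.exp (2 * n - θ * U n ω))) n
      have h3 := (ENNReal.ofReal_le_iff_le_toReal hω.ne).1 h2
      rw [hZ, Real.le_log_iff_exp_le (by have := (W ω).toReal_nonneg; linarith)]
      have h4 : Real.exp (2 * n - θ * t) ≤ Real.exp (2 * n - θ * U n ω) :=
        Real.exp_le_exp.2 (by nlinarith)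
      linarith
    have hlin : (firstExit U t ω : ℝ) ≤ 1 + θ * t + Z ω := by
      rcases eq_or_ne (firstExit U t ω) 0 with h0 | h0
      · rw [h0]
        have := hZ0 ω
        have : 0 ≤ θ * t := mul_nonneg hθ t.2
        simp only [NNReal.coe_zero]
        linarith
      -- Take n = ⌈V⌉ − 1, the integer with n < V ≤ n + 1.
      · have hc : 0 < ⌈firstExit U t ω⌉₊ := Nat.ceil_pos.2 (pos_iff_ne_zero.2 h0)
        obtain ⟨n, hn⟩ := Nat.exists_eq_succ_of_ne_zero hc.ne'
        have h1 := key n (Nat.lt_ceil.1 (by omega))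
        have h2 : firstExit U t ω ≤ (n + 1 : ℕ) := by
          have := Nat.le_ceil (firstExit U t ω)
          rwa [hn] at this
        have h3 : (firstExit U t ω : ℝ) ≤ n + 1 := by exact_mod_cast h2
        have : (0 : ℝ) ≤ n := by positivity
        linarith
    refine hlin.trans ?_
    have h1 := hZ0 ω
    have h2 : (0 : ℝ) ≤ t := t.2
    have e : (1 + θ) * (1 + t) * (1 + Z ω) - (1 + θ * t + Z ω)
        = t + θ + t * Z ω + θ * Z ω + θ * t * Z ω := by ring
    have : 0 ≤ t + θ + t * Z ω + θ * Z ω + θ * t * Z ω := by positivity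
    linarith

end IsGammaProcess

/-! ### A measurable version of the exit time -/

section ExitTime

open Classical in
/-- First passage of a path above the level `s`, computed along a countable dense set of times. -/
noncomputable def exitTime (s : ℝ) (u : ℝ≥0 → ℝ) : ℝ≥0 :=
  (⨅ i : ℕ, if s < u (TopologicalSpace.denseSeq ℝ≥0 i) then
    ((TopologicalSpace.denseSeq ℝ≥0 i : ℝ≥0) : ℝ≥0∞) else ∞).toNNReal

lemma measurable_exitTime (s : ℝ) : Measurable (exitTime s) := by
  refine ENNReal.measurable_toNNReal.comp (Measurable.iInf fun i => ?_)
  refine Measurable.ite ?_ measurable_const measurable_const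
  exact measurableSet_lt measurable_const (measurable_pi_apply _)

/-- By right-continuity, a path above `s` at τ stays above it just after τ, where the dense sequence
has points; so the countable infimum loses nothing. If the level is never exceeded, both sides
default to 0. -/
lemma exitTime_eq_sInf {u : ℝ≥0 → ℝ} (hu : ∀ t, ContinuousWithinAt u (Set.Ici t) t) (s : ℝ) :
    exitTime s u = sInf {τ : ℝ≥0 | s < u τ} := by
  rcases Set.eq_empty_or_nonempty {τ : ℝ≥0 | s < u τ} with he | hne
  · have h : ∀ τ, ¬ s < u τ := fun τ hτ => (Set.eq_empty_iff_forall_notMem.1 he τ) hτ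
    simp [exitTime, h]
  · have : (⨅ i : ℕ, if s < u (TopologicalSpace.denseSeq ℝ≥0 i) then
        ((TopologicalSpace.denseSeq ℝ≥0 i : ℝ≥0) : ℝ≥0∞) else ∞)
        = ((sInf {τ : ℝ≥0 | s < u τ} : ℝ≥0) : ℝ≥0∞) := by
      refine le_antisymm ?_ (le_iInf fun i => ?_)
      · refine le_of_forall_gt fun b hb => ?_
        obtain ⟨c, hc, hcb⟩ := ENNReal.lt_iff_exists_nnreal_btwn.1 hb
        obtain ⟨τ, hτ, hτc⟩ := exists_lt_of_csInf_lt hne (ENNReal.coe_lt_coe.1 hc)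
        obtain ⟨d, hd, hdu⟩ := (mem_nhdsGE_iff_exists_Ico_subset' hτc).1
          (hu τ (Ioi_mem_nhds hτ))
        obtain ⟨i, hi⟩ := (TopologicalSpace.denseRange_denseSeq ℝ≥0).exists_mem_open isOpen_Ioo
          (Set.nonempty_Ioo.2 (lt_min hτc hd))
        have hsi : s < u (TopologicalSpace.denseSeq ℝ≥0 i) :=
          hdu ⟨hi.1.le, hi.2.trans_le (min_le_right _ _)⟩
        refine (iInf_le _ i).trans_lt ?_
        rw [if_pos hsi]
        exact (ENNReal.coe_lt_coe.2 (hi.2.trans_le (min_le_left _ _))).trans hcb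
      · split_ifs with h
        · exact ENNReal.coe_le_coe.2 (csInf_le (OrderBot.bddBelow _) h)
        · exact le_top
    rw [exitTime, this, ENNReal.toNNReal_coe]

lemma sInf_exit_pos {u : ℝ≥0 → ℝ} (hu : ContinuousWithinAt u (Set.Ici 0) 0) 
    (hu0 : u 0 = 0) {s : ℝ} (hs : 0 < s) (hne : {τ : ℝ≥0 | s < u τ}.Nonempty) :
    0 < sInf {τ : ℝ≥0 | s < u τ} := by
  have hmem : u ⁻¹' (Set.Iio s) ∈ 𝓝[≥] (0 : ℝ≥0) := hu (Iio_mem_nhds (by rwa [hu0]))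
  obtain ⟨c, hc, hcu⟩ := (mem_nhdsGE_iff_exists_Ico_subset' (one_pos : (0 : ℝ≥0) < 1)).1 hmem
  refine lt_of_lt_of_le hc (le_csInf hne fun τ hτ => ?_)
  by_contra! h
  exact lt_asymm (show u τ < s from hcu ⟨zero_le, h⟩) hτ

end ExitTime

/-! ### Jointly measurable evaluation of a path at a random time -/

section PathEval

/-- Evaluation of a path as a limit of evaluations on grids of times; it is jointly measurable in
path and time and agrees with evaluation on continuous paths. -/
noncomputable def pathEval (w : ℝ≥0 → ℝ) (τ : ℝ≥0) : ℝ :=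
  limsup (fun n : ℕ => w ((⌈(n + 1 : ℝ≥0) * τ⌉₊ : ℝ≥0) / (n + 1))) atTop

/-- Each grid evaluation factors through a path and a natural number, a countable parameter, so
measurability reduces to that of single coordinates. -/
lemma measurable_pathEval : Measurable fun p : (ℝ≥0 → ℝ) × ℝ≥0 => pathEval p.1 p.2 := by
  refine Measurable.limsup fun n => ?_
  have h1 : Measurable fun p : (ℝ≥0 → ℝ) × ℕ => p.1 ((p.2 : ℝ≥0) / (n + 1)) :=
    measurable_from_prod_countable_left fun k =>
      measurable_pi_apply ((k : ℝ≥0) / (n + 1))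
  have h2 : Measurable fun p : (ℝ≥0 → ℝ) × ℝ≥0 => (p.1, ⌈(n + 1 : ℝ≥0) * p.2⌉₊) :=
    measurable_fst.prodMk (Nat.measurable_ceil.comp (measurable_snd.const_mul _))
  exact h1.comp h2

lemma tendsto_ceil_mul_div (τ : ℝ≥0) :
    Tendsto (fun n : ℕ => (⌈(n + 1 : ℝ≥0) * τ⌉₊ : ℝ≥0) / (n + 1)) atTop (𝓝 τ) := by
  have hup : Tendsto (fun n : ℕ => τ + 1 / ((n : ℝ≥0) + 1)) atTop (𝓝 τ) := by
    have h : Tendsto (fun n : ℕ => 1 / ((n : ℝ≥0) + 1)) atTop (𝓝 0) := by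
      rw [← NNReal.tendsto_coe]
      simpa using tendsto_one_div_add_atTop_nhds_zero_nat (𝕜 := ℝ)
    simpa using h.const_add τ
  refine tendsto_of_tendsto_of_tendsto_of_le_of_le tendsto_const_nhds hup (fun n => ?_)
    (fun n => ?_)
  · have h : (0 : ℝ≥0) < n + 1 := by positivity
    change τ ≤ _ / _
    rw [le_div_iff₀ h, mul_comm]
    exact Nat.le_ceil _
  · have h : (0 : ℝ≥0) < n + 1 := by positivity
    change _ / _ ≤ _
    rw [div_le_iff₀ h, add_mul τ, one_div, inv_mul_cancel₀ h.ne', mul_comm τ]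
    exact (Nat.ceil_lt_add_one zero_le).le

lemma pathEval_eq {w : ℝ≥0 → ℝ} (hw : Continuous w) (τ : ℝ≥0) : pathEval w τ = w τ :=
  ((hw.tendsto τ).comp (tendsto_ceil_mul_div τ)).limsup_eq

attribute [irreducible] pathEval

end PathEval

/-! ### Integrating out one of two independent variables -/

section Fubini

variable {Ω E F : Type*} [MeasurableSpace Ω] [MeasurableSpace E] [MeasurableSpace F]
  {P : Measure Ω} [IsProbabilityMeasure P] {X : Ω → E} {S : Ω → F}

/-- The joint law is a product, so Tonelli applies; this replaces conditioning on `S`. -/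
lemma ProbabilityTheory.IndepFun.lintegral_comp_prodMk (hXS : IndepFun X S P) (hX : Measurable X)
    (hS : Measurable S) {f : E × F → ℝ≥0∞} (hf : Measurable f) :
    ∫⁻ ω, f (X ω, S ω) ∂P = ∫⁻ ω, ∫⁻ ω', f (X ω', S ω) ∂P ∂P := by
  have := Measure.isProbabilityMeasure_map (μ := P) hX.aemeasurable
  have := Measure.isProbabilityMeasure_map (μ := P) hS.aemeasurable
  rw [← lintegral_map (f := f) hf (hX.prodMk hS),
    hXS.map_prod_eq_prod_map_map hX.aemeasurable hS.aemeasurable,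
    lintegral_prod_symm _ hf.aemeasurable, lintegral_map hf.lintegral_prod_left' hS]
  refine lintegral_congr fun ω => ?_
  exact lintegral_map (hf.comp (measurable_id.prodMk measurable_const)) hX

lemma ProbabilityTheory.IndepFun.integral_comp_prodMk (hXS : IndepFun X S P) (hX : Measurable X)
    (hS : Measurable S) {f : E × F → ℝ} (hf : Measurable f)
    (hint : Integrable (fun ω => f (X ω, S ω)) P) :
    ∫ ω, f (X ω, S ω) ∂P = ∫ ω, ∫ ω', f (X ω', S ω) ∂P ∂P := by
  have := Measure.isProbabilityMeasure_map (μ := P) hX.aemeasurable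
  have := Measure.isProbabilityMeasure_map (μ := P) hS.aemeasurable
  have hmap := hXS.map_prod_eq_prod_map_map hX.aemeasurable hS.aemeasurable
  have hint' : Integrable f ((P.map X).prod (P.map S)) := by
    rw [← hmap]
    exact (integrable_map_measure hf.aestronglyMeasurable (hX.prodMk hS).aemeasurable).2 hint
  rw [← integral_map (f := f) (hX.prodMk hS).aemeasurable hf.aestronglyMeasurable, hmap,
    integral_prod_symm _ hint', integral_map hS.aemeasurable]
  · refine integral_congr_ae (ae_of_all _ fun ω => ?_)
    exact integral_map hX.aemeasurable
      (hf.comp (measurable_id.prodMk measurable_const)).aestronglyMeasurable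
  · exact hf.stronglyMeasurable.integral_prod_left'.aestronglyMeasurable

end Fubini

/-! ### Moments of fractional Brownian motion at independent random times -/

namespace IsFBM

variable {Ω : Type*} [MeasurableSpace Ω] {P : Measure Ω} {H : ℝ}
  {B : ℝ≥0 → Ω → ℝ}

lemma memLp_two (hB : IsFBM H B P) (t : ℝ≥0) : MemLp (B t) 2 P :=
  (hB.gaussian.hasGaussianLaw_eval t).memLp_two

lemma integral_mul [IsProbabilityMeasure P] (hB : IsFBM H B P) (s t : ℝ≥0) : ∫ ω, B s ω * B t ω ∂P =
    ((s : ℝ) ^ (2 * H) + (t : ℝ) ^ (2 * H) - |(t : ℝ) - (s : ℝ)| ^ (2 * H)) / 2 := by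
  have h := covariance_eq_sub (hB.memLp_two s) (hB.memLp_two t)
  rw [hB.covariance_eq, hB.centered, hB.centered] at h
  simpa using h.symm

lemma measurable_path (hB : IsFBM H B P) : Measurable fun ω t => B t ω :=
  measurable_pi_iff.2 hB.measurable

lemma ae_pathEval (hB : IsFBM H B P) :
    ∀ᵐ ω ∂P, ∀ τ, pathEval (fun t => B t ω) τ = B τ ω := by
  filter_upwards [hB.continuous] with ω hω τ using pathEval_eq hω τ

variable [IsProbabilityMeasure P] {S T : Ω → ℝ≥0}

/-- With the time frozen at τ the second moment is τ^(2H). The nonnegative form of Fubini is used,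
since integrability is what is being proved. -/
lemma memLp_pathEval (hB : IsFBM H B P) (hH : 0 < H) (hS : Measurable S)
    (hind : IndepFun (fun ω t => B t ω) S P) (hint : Integrable (fun ω => (S ω : ℝ) ^ (2 * H)) P) :
    MemLp (fun ω => pathEval (fun t => B t ω) (S ω)) 2 P := by
  have hm : Measurable fun ω => pathEval (fun t => B t ω) (S ω) :=
    measurable_pathEval.comp (hB.measurable_path.prodMk hS)
  rw [memLp_two_iff_integrable_sq hm.aestronglyMeasurable]
  refine ⟨(hm.pow_const 2).aestronglyMeasurable, ?_⟩
  rw [hasFiniteIntegral_iff_enorm]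
  have h := hind.lintegral_comp_prodMk hB.measurable_path hS
    (f := fun p => ‖pathEval p.1 p.2 ^ 2‖ₑ) (measurable_pathEval.pow_const 2).enorm
  rw [h]
  have h2 : ∀ τ : ℝ≥0, ∫⁻ ω, ‖pathEval (fun t => B t ω) τ ^ 2‖ₑ ∂P
      = ‖(τ : ℝ) ^ (2 * H)‖ₑ := by
    intro τ
    have h3 : ∫⁻ ω, ‖pathEval (fun t => B t ω) τ ^ 2‖ₑ ∂P
        = ∫⁻ ω, ENNReal.ofReal (B τ ω * B τ ω) ∂P := by
      refine lintegral_congr_ae ?_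
      filter_upwards [hB.ae_pathEval] with ω hω
      rw [hω, Real.enorm_eq_ofReal (sq_nonneg _), sq]
    rw [h3, ← ofReal_integral_eq_lintegral_ofReal, hB.integral_mul,
      Real.enorm_eq_ofReal (by positivity)]
    · congr 1
      rw [sub_self, abs_zero, Real.zero_rpow (by positivity)]
      ring
    · simpa [sq] using (hB.memLp_two τ).integrable_sq
    · exact ae_of_all _ fun ω => mul_self_nonneg _
  simp_rw [h2]
  exact hint.2

lemma integral_pathEval (hB : IsFBM H B P) (hS : Measurable S)
    (hind : IndepFun (fun ω t => B t ω) S P)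
    (hint : Integrable (fun ω => pathEval (fun t => B t ω) (S ω)) P) :
    ∫ ω, pathEval (fun t => B t ω) (S ω) ∂P = 0 := by
  rw [hind.integral_comp_prodMk hB.measurable_path hS (f := fun p => pathEval p.1 p.2)
    measurable_pathEval hint]
  have : ∀ τ, ∫ ω, pathEval (fun t => B t ω) τ ∂P = 0 := by
    intro τ
    rw [← hB.centered τ]
    refine integral_congr_ae ?_
    filter_upwards [hB.ae_pathEval] with ω hω using hω τ
  simp [this]

lemma integral_pathEval_mul (hB : IsFBM H B P) (hS : Measurable S) (hT : Measurable T)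
    (hind : IndepFun (fun ω t => B t ω) (fun ω => (S ω, T ω)) P)
    (hint : Integrable
      (fun ω => pathEval (fun t => B t ω) (S ω) * pathEval (fun t => B t ω) (T ω)) P) :
    ∫ ω, pathEval (fun t => B t ω) (S ω) * pathEval (fun t => B t ω) (T ω) ∂P =
      ∫ ω, ((S ω : ℝ) ^ (2 * H) + (T ω : ℝ) ^ (2 * H) - |(T ω : ℝ) - (S ω : ℝ)| ^ (2 * H)) / 2
        ∂P := by
  rw [hind.integral_comp_prodMk hB.measurable_path (hS.prodMk hT)
    (f := fun p => pathEval p.1 p.2.1 * pathEval p.1 p.2.2)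
    ((measurable_pathEval.comp (by fun_prop : Measurable
        fun p : (ℝ≥0 → ℝ) × ℝ≥0 × ℝ≥0 => (p.1, p.2.1))).mul
      (measurable_pathEval.comp (by fun_prop : Measurable
        fun p : (ℝ≥0 → ℝ) × ℝ≥0 × ℝ≥0 => (p.1, p.2.2)))) hint]
  refine integral_congr_ae (ae_of_all _ fun ω => ?_)
  change _ = ((S ω : ℝ) ^ (2 * H) + (T ω : ℝ) ^ (2 * H) - |(T ω : ℝ) - (S ω : ℝ)| ^ (2 * H)) / 2
  rw [← hB.integral_mul]
  refine integral_congr_ae ?_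
  filter_upwards [hB.ae_pathEval] with ω' hω'
  simp only [hω']

end IsFBM

/-! ### Asymptotics and bounds for increments of powers -/

section RpowIncrement

lemma tendsto_nnreal_coe_rpow_neg {a : ℝ} (ha : 0 < a) :
    Tendsto (fun t : ℝ≥0 => (t : ℝ) ^ (-a)) atTop (𝓝 0) :=
  (tendsto_rpow_neg_atTop ha).comp (NNReal.tendsto_coe_atTop.2 tendsto_id)

lemma tendsto_rpow_sub_rpow_div {v : ℝ≥0 → ℝ} {μ : ℝ} (hμ : 0 < μ)
    (hv : Tendsto (fun t : ℝ≥0 => v t / t) atTop (𝓝 μ)) (p a : ℝ) :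
    Tendsto (fun t : ℝ≥0 => (v t ^ p - |v t - a| ^ p) / (t : ℝ) ^ (p - 1)) atTop
      (𝓝 (p * μ ^ (p - 1) * a)) := by
  have hinv : Tendsto (fun t : ℝ≥0 => a / (t : ℝ)) atTop (𝓝 0) :=
    tendsto_const_nhds.div_atTop (NNReal.tendsto_coe_atTop.2 tendsto_id)
  have hy : Tendsto (fun t : ℝ≥0 => v t / t - a / t) atTop (𝓝 μ) := by
    simpa using hv.sub hinv
  -- After scaling by t, both v/t and v/t − a/t move towards μ, so strict differentiability at μ is
  -- needed.
  have hd := (Real.hasStrictDerivAt_rpow_const (x := μ) (p := p) (Or.inl hμ.ne')).isLittleO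
  have ho := hd.comp_tendsto (hv.prodMk_nhds hy)
  have hO : (fun t : ℝ≥0 => v t / t - (v t / t - a / t)) =O[atTop] fun t : ℝ≥0 => (t : ℝ)⁻¹ := by
    have : (fun t : ℝ≥0 => v t / t - (v t / t - a / t)) = fun t : ℝ≥0 => a * (t : ℝ)⁻¹ := by
      funext t; rw [sub_sub_cancel, div_eq_mul_inv]
    rw [this]
    exact (isBigO_refl _ _).const_mul_left a
  have h2 := (ho.trans_isBigO hO).tendsto_div_nhds_zero
  have h3 := h2.add_const (p * μ ^ (p - 1) * a)
  rw [zero_add] at h3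
  refine h3.congr' ?_
  filter_upwards [eventually_gt_atTop 0, hv.eventually_const_lt hμ,
    hy.eventually_const_lt hμ] with t ht hx hy
  have ht' : (0 : ℝ) < t := by exact_mod_cast ht
  have hvt : 0 < v t := by
    have := mul_pos hx ht'
    rwa [div_mul_cancel₀ _ ht'.ne'] at this
  have hva : 0 < v t - a := by
    have := mul_pos hy ht'
    rwa [← sub_div, div_mul_cancel₀ _ ht'.ne'] at this
  simp only [Function.comp]
  rw [abs_of_pos hva, ← sub_div, Real.div_rpow hvt.le ht'.le, Real.div_rpow hva.le ht'.le,
    Real.rpow_sub_one ht'.ne']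
  have : (t : ℝ) ^ p ≠ 0 := by positivity
  simp only [ContinuousLinearMap.toSpanSingleton_apply, smul_eq_mul, div_inv_eq_mul]
  field_simp
  ring

/-- Bernoulli's inequality for 1 − a/b, scaled by b^p. -/
lemma rpow_sub_rpow_le_of_one_le {a b p : ℝ} (ha : 0 ≤ a) (hab : a ≤ b) (hp : 1 ≤ p) :
    b ^ p - (b - a) ^ p ≤ p * b ^ (p - 1) * a := by
  rcases (ha.trans hab).eq_or_lt with hb | hb
  · have : a = 0 := by linarith
    simp [this]
  have h := one_add_mul_self_le_rpow_one_add (s := -(a / b))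
    (by have := (div_le_one hb).2 hab; linarith) hp
  have e : (b - a) ^ p = b ^ p * (1 + -(a / b)) ^ p := by
    rw [← Real.mul_rpow hb.le (by have := (div_le_one hb).2 hab; linarith)]
    congr 1
    field_simp
    ring
  rw [e, Real.rpow_sub_one hb.ne']
  have h2 := mul_le_mul_of_nonneg_left h (Real.rpow_nonneg hb.le p)
  calc b ^ p - b ^ p * (1 + -(a / b)) ^ p ≤ b ^ p - b ^ p * (1 + p * -(a / b)) := by linarith
    _ = p * (b ^ p / b) * a := by field_simp; ring

lemma rpow_sub_rpow_le_of_le_one {a b p : ℝ} (ha : 0 ≤ a) (hab : a ≤ b) (hp0 : 0 ≤ p)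
    (hp : p ≤ 1) : b ^ p - (b - a) ^ p ≤ a ^ p := by
  have h := Real.rpow_add_le_add_rpow (sub_nonneg.2 hab) ha hp0 hp
  rw [sub_add_cancel] at h
  linarith

end RpowIncrement

/-- A measurable, almost surely nondecreasing process of linear growth rate `μ`, positive at
positive times, with a square-integrable linear majorant. -/
structure HasLinearGrowth {Ω : Type*} [MeasurableSpace Ω] (V : ℝ≥0 → Ω → ℝ≥0) (μ K : ℝ)
    (D : Ω → ℝ) (P : Measure Ω) : Prop where
  measurable : ∀ t, Measurable (V t)
  mono : ∀ᵐ ω ∂P, Monotone fun t => V t ω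
  rate_pos : 0 < μ
  tendsto : ∀ᵐ ω ∂P, Tendsto (fun t : ℝ≥0 => (V t ω : ℝ) / t) atTop (𝓝 μ)
  pos : ∀ s, 0 < s → ∀ᵐ ω ∂P, 0 < V s ω
  one_le_const : 1 ≤ K
  one_le_factor : ∀ ω, 1 ≤ D ω
  integrable_sq : Integrable (fun ω => D ω ^ 2) P
  le : ∀ᵐ ω ∂P, ∀ t : ℝ≥0, (V t ω : ℝ) ≤ K * (1 + t) * D ω

/-! ### Moment asymptotics by dominated convergence -/

namespace HasLinearGrowth

variable {Ω : Type*} [MeasurableSpace Ω] {P : Measure Ω}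
  {V : ℝ≥0 → Ω → ℝ≥0} {μ K : ℝ} {D : Ω → ℝ}

lemma measurable_rpow (h : HasLinearGrowth V μ K D P) (t : ℝ≥0) (p : ℝ) :
    Measurable fun ω => (V t ω : ℝ) ^ p :=
  (measurable_coe_nnreal_real.comp (h.measurable t)).pow_const p

lemma measurable_abs_sub_rpow (h : HasLinearGrowth V μ K D P) (s t : ℝ≥0) (p : ℝ) :
    Measurable fun ω => |(V t ω : ℝ) - V s ω| ^ p :=
  (((measurable_coe_nnreal_real.comp (h.measurable t)).sub
    (measurable_coe_nnreal_real.comp (h.measurable s))).abs).pow_const p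

lemma rpow_le_sq {x y p : ℝ} (hx : 0 ≤ x) (hxy : x ≤ y) (hy : 1 ≤ y) (hp0 : 0 ≤ p) (hp : p ≤ 2) :
    x ^ p ≤ y ^ 2 := by
  refine (Real.rpow_le_rpow hx hxy hp0).trans ?_
  rw [← Real.rpow_two]
  exact Real.rpow_le_rpow_of_exponent_le hy hp

lemma integrable_rpow (h : HasLinearGrowth V μ K D P) (t : ℝ≥0) {p : ℝ} (hp0 : 0 ≤ p)
    (hp : p ≤ 2) : Integrable (fun ω => (V t ω : ℝ) ^ p) P := by
  refine (h.integrable_sq.const_mul ((K * (1 + t)) ^ 2)).mono'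
    (h.measurable_rpow t p).aestronglyMeasurable ?_
  filter_upwards [h.le] with ω hω
  rw [Real.norm_of_nonneg (by positivity), ← mul_pow]
  have ht : (0 : ℝ) ≤ t := t.2
  refine rpow_le_sq (V t ω).2 (hω t) ?_ hp0 hp
  have h1 := h.one_le_const
  have h2 := h.one_le_factor ω
  have h3 : 1 ≤ K * (1 + t) := one_le_mul_of_one_le_of_one_le h1 (by linarith)
  exact one_le_mul_of_one_le_of_one_le h3 h2

lemma integrable_abs_sub_rpow (h : HasLinearGrowth V μ K D P) {s t : ℝ≥0} (hst : s ≤ t) {p : ℝ}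
    (hp0 : 0 ≤ p) (hp : p ≤ 2) : Integrable (fun ω => |(V t ω : ℝ) - V s ω| ^ p) P := by
  refine (h.integrable_rpow t hp0 hp).mono' (h.measurable_abs_sub_rpow s t p).aestronglyMeasurable
    ?_
  filter_upwards [h.mono] with ω hω
  have h1 : (V s ω : ℝ) ≤ V t ω := by exact_mod_cast hω hst
  have h2 : (0 : ℝ) ≤ V s ω := (V s ω).2
  rw [Real.norm_of_nonneg (by positivity), abs_of_nonneg (by linarith)]
  exact Real.rpow_le_rpow (by linarith) (by linarith) hp0

lemma integral_rpow_pos [IsProbabilityMeasure P]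
    (h : HasLinearGrowth V μ K D P) {s : ℝ≥0} (hs : 0 < s) {p : ℝ}
    (hp0 : 0 ≤ p) (hp : p ≤ 2) : 0 < ∫ ω, (V s ω : ℝ) ^ p ∂P := by
  rw [integral_pos_iff_support_of_nonneg_ae (ae_of_all _ fun ω => by positivity)
    (h.integrable_rpow s hp0 hp)]
  have : Function.support (fun ω => (V s ω : ℝ) ^ p) =ᵐ[P] Set.univ := by
    filter_upwards [h.pos s hs] with ω hω
    have : (0 : ℝ) < V s ω := by exact_mod_cast hω
    exact eq_true (Real.rpow_pos_of_pos this p).ne'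
  rw [measure_congr this]
  simp

/-- Domination uniform in t ≥ 1, from 1 + t ≤ 2t. The bound 1 ≤ 2KD allows exponents to be raised.
-/
lemma div_le (h : HasLinearGrowth V μ K D P) :
    ∀ᵐ ω ∂P, ∀ t : ℝ≥0, 1 ≤ t → (V t ω : ℝ) / t ≤ 2 * K * D ω ∧ 1 ≤ 2 * K * D ω := by
  filter_upwards [h.le] with ω hω t ht
  have ht' : (1 : ℝ) ≤ t := by exact_mod_cast ht
  have h1 := h.one_le_const
  have h2 := h.one_le_factor ω
  have hKD : 1 ≤ K * D ω := one_le_mul_of_one_le_of_one_le h1 h2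
  refine ⟨?_, by linarith⟩
  rw [div_le_iff₀ (by linarith)]
  have := hω t
  nlinarith

/-- Moments of order at most two are asymptotic to the powers of `μ t`. -/
lemma tendsto_integral_rpow_div [IsProbabilityMeasure P]
    (h : HasLinearGrowth V μ K D P) {p : ℝ} (hp0 : 0 ≤ p)
    (hp : p ≤ 2) :
    Tendsto (fun t : ℝ≥0 => (∫ ω, (V t ω : ℝ) ^ p ∂P) / (t : ℝ) ^ p) atTop (𝓝 (μ ^ p)) := by
  have key : Tendsto (fun t : ℝ≥0 => ∫ ω, (V t ω : ℝ) ^ p / (t : ℝ) ^ p ∂P) atTop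
      (𝓝 (∫ _, μ ^ p ∂P)) := by
    refine tendsto_integral_filter_of_dominated_convergence
      (fun ω => (2 * K) ^ 2 * D ω ^ 2) ?_ ?_ (h.integrable_sq.const_mul _) ?_
    · exact Eventually.of_forall fun t =>
        ((h.measurable_rpow t p).div_const _).aestronglyMeasurable
    · filter_upwards [eventually_ge_atTop 1] with t ht
      filter_upwards [h.div_le] with ω hω
      rw [Real.norm_of_nonneg (by positivity), ← Real.div_rpow (V t ω).coe_nonneg t.coe_nonneg,
        ← mul_pow]
      exact rpow_le_sq (div_nonneg (V t ω).2 t.2) (hω t ht).1 (hω t ht).2 hp0 hp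
    · filter_upwards [h.tendsto] with ω hω
      refine (hω.rpow_const (p := p) (Or.inl h.rate_pos.ne')).congr fun t => ?_
      exact Real.div_rpow (V t ω).2 t.2 p
  simp only [integral_const, probReal_univ, one_smul] at key
  refine key.congr fun t => ?_
  exact integral_div _ _

/-- The increment of the moment, for exponents in `[1, 2]`. -/
lemma tendsto_integral_sub_div_of_one_le (h : HasLinearGrowth V μ K D P) (s : ℝ≥0) {p : ℝ}
    (hp1 : 1 ≤ p) (hp : p ≤ 2) :
    Tendsto (fun t : ℝ≥0 =>
        (∫ ω, ((V t ω : ℝ) ^ p - |(V t ω : ℝ) - V s ω| ^ p) ∂P) / (t : ℝ) ^ (p - 1)) atTop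
      (𝓝 (p * μ ^ (p - 1) * ∫ ω, (V s ω : ℝ) ∂P)) := by
  have key : Tendsto (fun t : ℝ≥0 =>
      ∫ ω, ((V t ω : ℝ) ^ p - |(V t ω : ℝ) - V s ω| ^ p) / (t : ℝ) ^ (p - 1) ∂P) atTop
      (𝓝 (∫ ω, p * μ ^ (p - 1) * (V s ω : ℝ) ∂P)) := by
    refine tendsto_integral_filter_of_dominated_convergence
      -- Product of (V(t)/t)^(p−1) ≤ 2KD and V(s) ≤ K(1+s)D, hence the need for D².
      (fun ω => p * (2 * K) * (K * (1 + s)) * D ω ^ 2) ?_ ?_ (h.integrable_sq.const_mul _) ?_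
    · exact Eventually.of_forall fun t =>
        (((h.measurable_rpow t p).sub (h.measurable_abs_sub_rpow s t p)).div_const
          _).aestronglyMeasurable
    · filter_upwards [eventually_ge_atTop 1, eventually_ge_atTop s] with t ht hst
      filter_upwards [h.div_le, h.mono, h.le] with ω hω hmono hle
      have ht0 : (0 : ℝ) < t := by exact_mod_cast lt_of_lt_of_le one_pos ht
      have h1 : (V s ω : ℝ) ≤ V t ω := by exact_mod_cast hmono hst
      have h2 : (0 : ℝ) ≤ V s ω := (V s ω).2
      have h3 : (0 : ℝ) ≤ V t ω := (V t ω).2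
      have hle' : ((V t ω : ℝ) - V s ω) ^ p ≤ (V t ω : ℝ) ^ p :=
        Real.rpow_le_rpow (by linarith) (by linarith) (by linarith)
      rw [abs_of_nonneg (by linarith), Real.norm_of_nonneg (div_nonneg (by linarith)
        (by positivity))]
      have h4 : ((V t ω : ℝ) ^ p - ((V t ω : ℝ) - V s ω) ^ p) / (t : ℝ) ^ (p - 1)
          ≤ p * ((V t ω : ℝ) / t) ^ (p - 1) * V s ω := by
        rw [Real.div_rpow h3 ht0.le, div_le_iff₀ (by positivity)]
        refine (rpow_sub_rpow_le_of_one_le h2 h1 hp1).trans (le_of_eq ?_)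
        have : (t : ℝ) ^ (p - 1) ≠ 0 := by positivity
        field_simp
      have h5 : ((V t ω : ℝ) / t) ^ (p - 1) ≤ 2 * K * D ω := by
        refine (Real.rpow_le_rpow (by positivity) (hω t ht).1 (by linarith)).trans ?_
        calc (2 * K * D ω) ^ (p - 1) ≤ (2 * K * D ω) ^ (1 : ℝ) :=
              Real.rpow_le_rpow_of_exponent_le (hω t ht).2 (by linarith)
          _ = _ := Real.rpow_one _
      have h6 := (hω t ht).2
      calc _ ≤ p * ((V t ω : ℝ) / t) ^ (p - 1) * V s ω := h4
        _ ≤ p * (2 * K * D ω) * (K * (1 + s) * D ω) := by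
          gcongr
          exact hle s
        _ = _ := by ring
    · filter_upwards [h.tendsto] with ω hω
      exact tendsto_rpow_sub_rpow_div h.rate_pos hω p _
  rw [integral_const_mul] at key
  refine key.congr fun t => ?_
  exact integral_div _ _

/-- The increment of the moment, for exponents in `(0, 1)`. -/
lemma tendsto_integral_sub_of_lt_one (h : HasLinearGrowth V μ K D P) (s : ℝ≥0) {p : ℝ}
    (hp0 : 0 ≤ p) (hp : p < 1) :
    Tendsto (fun t : ℝ≥0 =>
        ∫ ω, ((V t ω : ℝ) ^ p - |(V t ω : ℝ) - V s ω| ^ p) ∂P) atTop (𝓝 0) := by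
  rw [← integral_zero Ω ℝ (μ := P)]
  refine tendsto_integral_filter_of_dominated_convergence
    -- Subadditivity of x ↦ x^p for p ≤ 1 gives a majorant free of t.
    (fun ω => (V s ω : ℝ) ^ p) ?_ ?_ (h.integrable_rpow s hp0 (by linarith)) ?_
  · exact Eventually.of_forall fun t =>
      ((h.measurable_rpow t p).sub (h.measurable_abs_sub_rpow s t p)).aestronglyMeasurable
  · filter_upwards [eventually_ge_atTop s] with t hst
    filter_upwards [h.mono] with ω hmono
    have h1 : (V s ω : ℝ) ≤ V t ω := by exact_mod_cast hmono hst
    have h2 : (0 : ℝ) ≤ V s ω := (V s ω).2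
    have hle' : ((V t ω : ℝ) - V s ω) ^ p ≤ (V t ω : ℝ) ^ p :=
      Real.rpow_le_rpow (by linarith) (by linarith) hp0
    rw [abs_of_nonneg (by linarith), Real.norm_of_nonneg (by linarith)]
    exact rpow_sub_rpow_le_of_le_one h2 h1 hp0 hp.le
  · filter_upwards [h.tendsto] with ω hω
    have h1 := (tendsto_rpow_sub_rpow_div h.rate_pos hω p (V s ω)).mul
      (tendsto_nnreal_coe_rpow_neg (a := 1 - p) (by linarith))
    rw [mul_zero] at h1
    refine h1.congr' ?_
    filter_upwards [eventually_gt_atTop 0] with t ht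
    have ht' : (0 : ℝ) < t := by exact_mod_cast ht
    rw [show -(1 - p) = p - 1 by ring]
    have : (t : ℝ) ^ (p - 1) ≠ 0 := by positivity
    field_simp

/-- The expected fractional covariance along `V` is of exact order `t ^ max (p - 1) 0`. -/
lemma exists_tendsto_cov [IsProbabilityMeasure P]
    (h : HasLinearGrowth V μ K D P) {s : ℝ≥0} (hs : 0 < s) {p : ℝ}
    (hp0 : 0 < p) (hp : p < 2) :
    ∃ κ : ℝ, 0 < κ ∧ Tendsto (fun t : ℝ≥0 =>
      (∫ ω, ((V s ω : ℝ) ^ p + (V t ω : ℝ) ^ p - |(V t ω : ℝ) - V s ω| ^ p) / 2 ∂P)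
        / (t : ℝ) ^ (max (p - 1) 0)) atTop (𝓝 κ) := by
  set A := ∫ ω, (V s ω : ℝ) ^ p ∂P with hA
  have hApos : 0 < A := h.integral_rpow_pos hs hp0.le hp.le
  have hEpos : 0 < ∫ ω, (V s ω : ℝ) ∂P := by
    have := h.integral_rpow_pos hs (p := 1) (by norm_num) (by norm_num)
    simpa using this
  have hsplit : ∀ᶠ t : ℝ≥0 in atTop,
      (∫ ω, ((V s ω : ℝ) ^ p + (V t ω : ℝ) ^ p - |(V t ω : ℝ) - V s ω| ^ p) / 2 ∂P)
      = (A + ∫ ω, ((V t ω : ℝ) ^ p - |(V t ω : ℝ) - V s ω| ^ p) ∂P) / 2 := by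
    filter_upwards [eventually_ge_atTop s] with t hst
    have h2 : Integrable (fun ω => (V t ω : ℝ) ^ p - |(V t ω : ℝ) - V s ω| ^ p) P :=
      (h.integrable_rpow t hp0.le hp.le).sub (h.integrable_abs_sub_rpow hst hp0.le hp.le)
    rw [integral_div, hA, ← integral_add (h.integrable_rpow s hp0.le hp.le) h2]
    simp only [add_sub_assoc]
  rcases lt_or_ge p 1 with hp1 | hp1
  · refine ⟨A / 2, by positivity, ?_⟩
    have h1 := ((h.tendsto_integral_sub_of_lt_one s hp0.le hp1).const_add A).div_const 2
    rw [add_zero] at h1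
    refine h1.congr' ?_
    filter_upwards [hsplit] with t ht
    rw [ht, max_eq_right (by linarith), Real.rpow_zero, div_one]
  · have hB : 0 < p * μ ^ (p - 1) * ∫ ω, (V s ω : ℝ) ∂P := by
      have := h.rate_pos
      positivity
    -- At p = 1 the term E[V(s)^p] survives in the limit; for p > 1 it is negligible.
    obtain ⟨a, ha0, ha⟩ : ∃ a : ℝ, 0 ≤ a ∧
        Tendsto (fun t : ℝ≥0 => A / (t : ℝ) ^ (p - 1)) atTop (𝓝 a) := by
      rcases hp1.eq_or_lt with rfl | hp1
      · exact ⟨A, hApos.le, by simp⟩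
      · refine ⟨0, le_rfl, ?_⟩
        have := (tendsto_nnreal_coe_rpow_neg (a := p - 1) (by linarith)).const_mul A
        rw [mul_zero] at this
        refine this.congr fun t => ?_
        rw [Real.rpow_neg t.coe_nonneg, div_eq_mul_inv]
    refine ⟨(a + p * μ ^ (p - 1) * ∫ ω, (V s ω : ℝ) ∂P) / 2, by positivity, ?_⟩
    refine ((ha.add (h.tendsto_integral_sub_div_of_one_le s hp1 hp.le)).div_const 2).congr' ?_
    filter_upwards [hsplit] with t ht
    rw [ht, max_eq_left (by linarith)]
    ring

end HasLinearGrowth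

/-! ### Assembly -/

lemma IsGammaProcess.exists_hasLinearGrowth {Ω : Type*} [MeasurableSpace Ω] {P : Measure Ω}
    [IsProbabilityMeasure P] {ν : ℝ} {U : ℝ≥0 → Ω → ℝ} (hU : IsGammaProcess ν U P) (hν : 0 < ν) :
    ∃ (μ K : ℝ) (D : Ω → ℝ),
      HasLinearGrowth (fun t ω => exitTime t fun r => U r ω) μ K D P := by
  obtain ⟨m, hm, hlim⟩ := hU.exists_ae_tendsto_div hν
  obtain ⟨K, D, hK, hD1, hD2, hle⟩ := hU.exists_firstExit_le hν
  have heq : ∀ᵐ ω ∂P, ∀ t : ℝ≥0, exitTime t (fun r => U r ω)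
      = sInf {τ : ℝ≥0 | (t : ℝ) < U τ ω} := by
    filter_upwards [hU.cadlag] with ω hω t
    exact exitTime_eq_sInf (fun t => (hω t).1) t
  refine ⟨m⁻¹, K, D, ?_, ?_, inv_pos.2 hm, ?_, ?_, hK, hD1, hD2, ?_⟩
  · exact fun t => (measurable_exitTime t).comp (measurable_pi_iff.2 hU.measurable)
  · filter_upwards [heq, hlim] with ω h1 h2
    simp only [h1]
    exact monotone_sInf_exit hm h2
  · filter_upwards [heq, hlim, hU.ae_monotone] with ω h1 h2 h3
    simp only [h1]
    exact tendsto_sInf_exit_div h3 hm h2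
  · intro s hs
    filter_upwards [heq, hlim, hU.zero, hU.cadlag] with ω h1 h2 h3 h4
    rw [h1]
    exact sInf_exit_pos (h4 0).1 h3 (by exact_mod_cast hs) (exit_nonempty hm h2 s)
  · filter_upwards [heq, hle] with ω h1 h2 t
    rw [h1]
    exact h2 t

lemma ProbabilityTheory.covariance_congr_ae {Ω : Type*} [MeasurableSpace Ω] {P : Measure Ω}
    {X X' Y Y' : Ω → ℝ} (hX : X =ᵐ[P] X') (hY : Y =ᵐ[P] Y') :
    cov[X, Y; P] = cov[X', Y'; P] := by
  rw [covariance, covariance, integral_congr_ae hX, integral_congr_ae hY]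
  refine integral_congr_ae ?_
  filter_upwards [hX, hY] with ω h1 h2
  rw [h1, h2]

theorem mainTheorem1 {Ω : Type*} [MeasurableSpace Ω] (P : Measure Ω) [IsProbabilityMeasure P]
    (H ν : ℝ) (hH : H ∈ Set.Ioo (0 : ℝ) 1) (hν : 0 < ν)
    (B U : ℝ≥0 → Ω → ℝ) (hB : IsFBM H B P) (hU : IsGammaProcess ν U P)
    (hBU : IndepFun (fun ω t => B t ω) (fun ω t => U t ω) P) :
    HasLRD (timeChange B (firstExit U)) P := by
  obtain ⟨hH0, hH1⟩ := hH
  obtain ⟨μ, K, D, hV⟩ := hU.exists_hasLinearGrowth hν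
  set V : ℝ≥0 → Ω → ℝ≥0 := fun t ω => exitTime t fun r => U r ω with hVdef
  -- A measurable modification of the time-changed process; covariances and variances are
  -- unaffected.
  set Y : ℝ≥0 → Ω → ℝ := fun t ω => pathEval (fun r => B r ω) (V t ω) with hYdef
  have hYeq : ∀ t, timeChange B (firstExit U) t =ᵐ[P] Y t := by
    intro t
    filter_upwards [hB.ae_pathEval, hU.cadlag] with ω h1 h2
    change B (firstExit U t ω) ω = pathEval (fun r => B r ω) (V t ω)
    rw [h1, show V t ω = firstExit U t ω from exitTime_eq_sInf (fun t => (h2 t).1) t]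
  have hind : ∀ t, IndepFun (fun ω t => B t ω) (V t) P := fun t =>
    hBU.comp measurable_id (measurable_exitTime t)
  have hind2 : ∀ s t, IndepFun (fun ω t => B t ω) (fun ω => (V s ω, V t ω)) P := fun s t =>
    hBU.comp measurable_id ((measurable_exitTime s).prodMk (measurable_exitTime t))
  have hYmem : ∀ t, MemLp (Y t) 2 P := fun t =>
    hB.memLp_pathEval hH0 (hV.measurable t) (hind t)
      (hV.integrable_rpow t (by linarith) (by linarith))
  have hY0 : ∀ t, ∫ ω, Y t ω ∂P = 0 := fun t =>
    hB.integral_pathEval (hV.measurable t) (hind t) ((hYmem t).integrable (by norm_num))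
  have hcov : ∀ s t, cov[Y s, Y t; P] = ∫ ω, ((V s ω : ℝ) ^ (2 * H) + (V t ω : ℝ) ^ (2 * H)
      - |(V t ω : ℝ) - V s ω| ^ (2 * H)) / 2 ∂P := by
    intro s t
    rw [covariance_eq_sub (hYmem s) (hYmem t), hY0, zero_mul, sub_zero]
    exact hB.integral_pathEval_mul (hV.measurable s) (hV.measurable t) (hind2 s t)
      ((hYmem s).integrable_mul (hYmem t))
  have hvar : ∀ t, Var[Y t; P] = ∫ ω, (V t ω : ℝ) ^ (2 * H) ∂P := by
    intro t
    rw [← covariance_self (hYmem t).aestronglyMeasurable.aemeasurable, hcov]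
    refine integral_congr_ae (ae_of_all _ fun ω => ?_)
    simp only [sub_self, abs_zero]
    rw [Real.zero_rpow (by positivity)]
    ring
  have hcorr : ∀ s t, corr (timeChange B (firstExit U) s) (timeChange B (firstExit U) t) P
      = (∫ ω, ((V s ω : ℝ) ^ (2 * H) + (V t ω : ℝ) ^ (2 * H)
        - |(V t ω : ℝ) - V s ω| ^ (2 * H)) / 2 ∂P) /
        (√(∫ ω, (V s ω : ℝ) ^ (2 * H) ∂P) * √(∫ ω, (V t ω : ℝ) ^ (2 * H) ∂P)) := by
    intro s t
    rw [corr, covariance_congr_ae (hYeq s) (hYeq t), variance_congr (hYeq s),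
      variance_congr (hYeq t), hcov, hvar, hvar]
  refine ⟨fun t => (hYmem t).ae_eq (hYeq t).symm, H - max (2 * H - 1) 0, ?_, ?_⟩
  · rcases max_cases (2 * H - 1) 0 with ⟨h1, h2⟩ | ⟨h1, h2⟩ <;> rw [h1] <;>
      constructor <;> linarith
  have hκ : ∀ s : ℝ≥0, ∃ κ : ℝ, 0 < s → 0 < κ ∧ Tendsto (fun t : ℝ≥0 =>
      (∫ ω, ((V s ω : ℝ) ^ (2 * H) + (V t ω : ℝ) ^ (2 * H)
        - |(V t ω : ℝ) - V s ω| ^ (2 * H)) / 2 ∂P)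
        / (t : ℝ) ^ (max (2 * H - 1) 0)) atTop (𝓝 κ) := by
    intro s
    by_cases hs : 0 < s
    · obtain ⟨κ, h1, h2⟩ := hV.exists_tendsto_cov hs (p := 2 * H) (by linarith) (by linarith)
      exact ⟨κ, fun _ => ⟨h1, h2⟩⟩
    · exact ⟨0, fun h => absurd h hs⟩
  choose κ hκ using hκ
  refine ⟨fun s => κ s / (√(∫ ω, (V s ω : ℝ) ^ (2 * H) ∂P) * √(μ ^ (2 * H))), fun s hs => ?_⟩
  obtain ⟨hκ0, hκlim⟩ := hκ s hs
  have hAs : 0 < √(∫ ω, (V s ω : ℝ) ^ (2 * H) ∂P) :=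
    Real.sqrt_pos.2 (hV.integral_rpow_pos hs (by linarith) (by linarith))
  have hμ : 0 < √(μ ^ (2 * H)) := Real.sqrt_pos.2 (Real.rpow_pos_of_pos hV.rate_pos _)
  have hc : 0 < κ s / (√(∫ ω, (V s ω : ℝ) ^ (2 * H) ∂P) * √(μ ^ (2 * H))) := by positivity
  refine ⟨hc.ne', ?_⟩
  -- The standard deviation has order t^H, which supplies the H in the decay exponent.
  have hsd : Tendsto (fun t : ℝ≥0 => √(∫ ω, (V t ω : ℝ) ^ (2 * H) ∂P) / (t : ℝ) ^ H) atTop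
      (𝓝 (√(μ ^ (2 * H)))) := by
    refine ((hV.tendsto_integral_rpow_div (p := 2 * H) (by linarith) (by linarith)).sqrt).congr
      fun t => ?_
    rw [Real.sqrt_div' _ (by positivity)]
    congr 1
    rw [mul_comm, Real.rpow_mul t.coe_nonneg, Real.rpow_two, Real.sqrt_sq (by positivity)]
  have hmain := hκlim.div (hsd.const_mul (√(∫ ω, (V s ω : ℝ) ^ (2 * H) ∂P)))
    (mul_pos hAs hμ).ne'
  have hone := hmain.div_const (κ s / (√(∫ ω, (V s ω : ℝ) ^ (2 * H) ∂P) * √(μ ^ (2 * H))))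
  rw [div_self hc.ne'] at hone
  have hpos : ∀ᶠ t : ℝ≥0 in atTop, (0 : ℝ) < t := by
    filter_upwards [eventually_gt_atTop 0] with t ht
    exact_mod_cast ht
  rw [isEquivalent_iff_tendsto_one]
  · refine hone.congr' ?_
    filter_upwards [hpos] with t ht
    simp only [Pi.div_apply]
    rw [hcorr, neg_sub, Real.rpow_sub ht]
    generalize (∫ ω, ((V s ω : ℝ) ^ (2 * H) + (V t ω : ℝ) ^ (2 * H)
        - |(V t ω : ℝ) - V s ω| ^ (2 * H)) / 2 ∂P) = a
    generalize √(∫ ω, (V t ω : ℝ) ^ (2 * H) ∂P) = b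
    have h1 : (t : ℝ) ^ H ≠ 0 := by positivity
    have h2 : (t : ℝ) ^ max (2 * H - 1) 0 ≠ 0 := by positivity
    -- When the standard deviation `b` is 0, both quotients are 0 by the convention for division by
    -- zero.
    rcases eq_or_ne b 0 with rfl | hb
    · simp
    field_simp
  · filter_upwards [hpos] with t ht
    exact mul_ne_zero hc.ne' (Real.rpow_pos_of_pos ht _).ne'
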